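/- Let $S$ be a measurable space, $A$ a standard Borel space (e.g. $\mathbb R^d$), and consider a discounted Markov decision process with transition kernel $T(ds'\mid s,a)$, bounded measurable reward $R:S\times A\to\mathbb R$ and discount factor $\gamma\in[0,1)$. Let $\eta>0$, let $\nu(\cdot\mid s)$ be a behavior policy (a Markov kernel from $S$ to $A$), let $N\in\mathbb N$, and let $p_N$ be a probability measure on $A$ (the prior noise, e.g. $\mathcal N(0,I)$). *Forward process.* Let $q_{n|n-1}$, $n=1,\dots,N$, be Markov kernels on $A$. For a probability measure $\rho$ on $A$ let $q^{\rho}_{0:N}$ be the law of the Markov chain $a^0\sim\rho$, $a^n\sim q_{n|n-1}(\cdot\mid a^{n-1})$, and write $q^{\nu,s}_{0:N}$ for $\rho=\nu(\cdot\mid s)$. Assume that the forward process ends in the prior noise: for every $s\in S$ and every probability measure $\rho\ll\nu(\cdot\mid s)$, the law of $a^N$ under $q^\rho_{0:N}$ is $p_N$. *Diffusion policies.* A diffusion policy $p^\pi$ is a family of Markov kernels $p^{\pi,s,x}_{n-1|n}(\cdot)$ from $S\times A\ni(s,x)$ to $A$, $n=1,\dots,N$; its path law $p^{\pi,s}_{0:N}$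 in state $s$ is the law of $(a^0,\dots,a^N)$ with $a^N\sim p_N$ and $a^{n-1}\sim p^{\pi,s,a^n}_{n-1|n}$. Let $p^\nu$ be the behavior diffusion process: a diffusion policy that for every $s\in S$ maximizes the evidence lower bound for data $a^0\sim\nu(\cdot\mid s)$ and the forward process $q$, that is, minimizes $\mathrm{KL}(q^{\nu,s}_{0:N}\,\|\,p^{s}_{0:N})$ over all diffusion policies $p$. *Pathwise KL-regularized problem.* Over all diffusion policies $p^\pi$ maximize, from every initial state $s_0\in S$, $$\mathbb E\Big[\sum_{t=0}^\infty\gamma^t\Big(R(s_t,a_t^0)-\eta\sum_{n=1}^N \mathrm{KL}\big(p^{\pi,s_t,a_t^n}_{n-1|n}\,\big\|\,p^{\nu,s_t,a_t^n}_{n-1|n}\big)\Big)\Big],\qquad a_t^{0:N}\sim p^{\pi,s_t}_{0:N},\quad s_{t+1}\sim T(\cdot\mid s_t,a_t^0).$$ *Action-level KL-regularized problem.* Over all policies $\pi$ (Markov kernels from $S$ to $A$) maximize, from every initial state $s_0\in S$, $$\mathbb E\Big[\sum_{t=0}^\infty\gamma^t\Big(R(s_t,a_t)-\eta\,\mathrm{KL}\big(\pi(\cdot\mid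 s_t)\,\big\|\,\nu(\cdot\mid s_t)\big)\Big)\Big],\qquad a_t\sim\pi(\cdot\mid s_t),\quad s_{t+1}\sim T(\cdot\mid s_t,a_t).$$ **Theorem.** The pathwise problem has an optimal diffusion policy, the action-level problem has a unique optimal policy $\pi^*$, and for every optimal diffusion policy $p^*$ of the pathwise problem and every $s\in S$, $$\pi^*(da\mid s)=\text{the law of } a^0 \text{ under } p^{*,s}_{0:N}\qquad\Big(\text{i.e. } \pi^*(a\mid s)=\int p^{*,s}_{0:N}(a^{0:N})\,\delta(a-a^0)\,da^{0:N}\Big).$$ Moreover $\mathrm{KL}(p^{*,s}_{0:N}\,\|\,p^{\nu,s}_{0:N})=\mathrm{KL}(\pi^*(\cdot\mid s)\,\|\,\nu(\cdot\mid s))$, and the optimal values of the two problems from the initial state $s$ are equal. -/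

import Mathlib

open MeasureTheory ProbabilityTheory InformationTheory Filter
open scoped ENNReal

namespace PathwiseKL

section Environment

/-- An infinite-horizon discounted Markov decision process with state space `S` and action space
`A`: transition kernel `T(ds' | s, a)`, bounded measurable reward `R(s, a)`, and discount factor
`γ ∈ [0, 1)`. -/
structure MDP (S A : Type*) [MeasurableSpace S] [MeasurableSpace A] where
  T : Kernel (S × A) S
  markov : IsMarkovKernel T
  R : S × A → ℝ
  measurable_R : Measurable R
  bounded_R : ∃ C : ℝ, ∀ z, |R z| ≤ C
  γ : ℝ
  γ_nonneg : 0 ≤ γ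
  γ_lt_one : γ < 1

instance {S A : Type*} [MeasurableSpace S] [MeasurableSpace A] (M : MDP S A) :
    IsMarkovKernel M.T := M.markov

/-- The law of the trajectory `(s₀, x₀), (s₁, x₁), …` with `s₀ = s`, `x_t ∼ κ(· | s_t)` and
`s_{t+1} ∼ P(· | s_t, x_t)`. Here `X` is whatever the agent generates at each environment step:
an action, or a whole diffusion path. -/
noncomputable def trajectoryLaw {S X : Type*} [MeasurableSpace S] [MeasurableSpace X]
    (P : Kernel (S × X) S) [IsMarkovKernel P] (κ : Kernel S X) [IsMarkovKernel κ] (s : S) :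
    Measure (ℕ → S × X) :=
  Kernel.trajMeasure (X := fun _ => S × X) ((Kernel.id ×ₖ κ) s)
    (fun n => ((Kernel.id ×ₖ κ) ∘ₖ P).comap
      (fun h => h ⟨n, Finset.mem_Iic.2 le_rfl⟩) (measurable_pi_apply _))

/-- `𝔼[∑ₜ γᵗ (r(s_t, x_t) - η c(s_t, x_t))]`, for a bounded reward `r` and a cost `c` with values
in `[0, ∞]`. The expected discounted reward is a real number and the expected discounted cost lies
in `[0, ∞]`, so that the difference is a well-defined element of `[-∞, ∞)`. -/
noncomputable def discountedReturn {Z : Type*} [MeasurableSpace Z] (γ η : ℝ) (r : Z → ℝ)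
    (c : Z → ℝ≥0∞) (law : Measure (ℕ → Z)) : EReal :=
  ((∫ ω, ∑' t : ℕ, γ ^ t * r (ω t) ∂law : ℝ) : EReal) -
    ((ENNReal.ofReal η * ∫⁻ ω, ∑' t : ℕ, ENNReal.ofReal γ ^ t * c (ω t) ∂law : ℝ≥0∞) : EReal)

variable {S A : Type*} [MeasurableSpace S] [MeasurableSpace A]

/-- The action-level KL-regularized objective
`𝔼[∑ₜ γᵗ (R(s_t, a_t) - η KL(π(· | s_t) ‖ ν(· | s_t)))]` from the initial state `s`. -/
noncomputable def actionObjective (M : MDP S A) (η : ℝ) (ν π : Kernel S A) [IsMarkovKernel π]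
    (s : S) : EReal :=
  discountedReturn M.γ η M.R (fun z => klDiv (π z.1) (ν z.1)) (trajectoryLaw M.T π s)

/-- `π` maximizes the action-level objective among all policies, from every initial state. -/
def IsActionOptimal (M : MDP S A) (η : ℝ) (ν π : Kernel S A) [IsMarkovKernel π] : Prop :=
  ∀ (π' : Kernel S A) [IsMarkovKernel π'] (s : S),
    actionObjective M η ν π' s ≤ actionObjective M η ν π s

end Environment

section Diffusion

lemma measurable_snoc {A : Type*} [MeasurableSpace A] (n : ℕ) :
    Measurable (fun z : (Fin n → A) × A => (Fin.snoc z.1 z.2 : Fin (n + 1) → A)) := by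
  refine measurable_pi_lambda _ fun i => ?_
  refine Fin.lastCases ?_ (fun j => ?_) i
  · simpa using measurable_snd
  · simp only [Fin.snoc_castSucc]
    exact (measurable_pi_apply j).comp measurable_fst

/-- The law of `(a⁰, …, aⁿ)` for the forward (noising) Markov chain `a⁰ ∼ ρ`,
`a^{k+1} ∼ q_{k+1|k}(· | a^k)`, where `q k` is the kernel `q_{k+1|k}`. -/
noncomputable def forwardLaw {A : Type*} [MeasurableSpace A] (q : ℕ → Kernel A A)
    (ρ : Measure A) : (n : ℕ) → Measure (Fin (n + 1) → A)
  | 0 => ρ.map (fun a _ => a)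
  | n + 1 => (forwardLaw q ρ n ⊗ₘ (q n).comap (fun w => w (Fin.last n))
      (measurable_pi_apply _)).map (fun z => Fin.snoc z.1 z.2)

variable {S A : Type*} [MeasurableSpace S] [MeasurableSpace A]

/-- A diffusion policy: state-conditioned reverse transition kernels, `trans n (s, x)` being
`p^s_{n|n+1}(· | x)`. A process with `N` diffusion steps uses `trans 0, …, trans (N - 1)` only. -/
structure DiffusionPolicy (S A : Type*) [MeasurableSpace S] [MeasurableSpace A] where
  trans : ℕ → Kernel (S × A) A
  markov : ∀ n, IsMarkovKernel (trans n)

instance (p : DiffusionPolicy S A) (n : ℕ) : IsMarkovKernel (p.trans n) := p.markov n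

namespace DiffusionPolicy

/-- The law of `(a⁰, …, aⁿ)` when the reverse chain is run in state `s` from `aⁿ = x`, as a kernel
in `(s, x)`: draw `a^{n-1} ∼ p^s_{n-1|n}(· | x)`, run the chain from there, and append `x`. -/
noncomputable def pathFrom (p : DiffusionPolicy S A) : (n : ℕ) → Kernel (S × A) (Fin (n + 1) → A)
  | 0 => Kernel.deterministic (fun z _ => z.2) (measurable_pi_lambda _ fun _ => measurable_snd)
  | n + 1 =>
    ((pathFrom p n ∘ₖ (Kernel.deterministic Prod.fst measurable_fst ×ₖ p.trans n)) ×ₖ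
        Kernel.deterministic Prod.snd measurable_snd).map
      (fun z => (Fin.snoc z.1 z.2 : Fin (n + 2) → A))

instance instIsMarkovKernelPathFrom (p : DiffusionPolicy S A) (n : ℕ) :
    IsMarkovKernel (p.pathFrom n) := by
  induction n with
  | zero => unfold pathFrom; infer_instance
  | succ n ih => unfold pathFrom; exact Kernel.IsMarkovKernel.map _ (measurable_snoc (n + 1))

/-- The law `p^s_{0:N}` of the diffusion path `(a⁰, …, a^N)` generated in state `s`, with
`a^N ∼ prior` and `a^{n-1} ∼ p^s_{n-1|n}(· | aⁿ)`, as a kernel in `s`. -/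
noncomputable def pathLaw (p : DiffusionPolicy S A) (prior : Measure A) (N : ℕ) :
    Kernel S (Fin (N + 1) → A) :=
  p.pathFrom N ∘ₖ (Kernel.id ×ₖ Kernel.const S prior)

instance (p : DiffusionPolicy S A) (prior : Measure A) [IsProbabilityMeasure prior] (N : ℕ) :
    IsMarkovKernel (p.pathLaw prior N) := by unfold pathLaw; infer_instance

/-- The accumulated penalty `∑_{n=1}^N KL(p^{s}_{n-1|n}(· | aⁿ) ‖ p^{ν,s}_{n-1|n}(· | aⁿ))` along
the diffusion path `w = (a⁰, …, a^N)` generated in state `s`. -/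
noncomputable def pathPenalty (p pν : DiffusionPolicy S A) (N : ℕ) (z : S × (Fin (N + 1) → A)) :
    ℝ≥0∞ :=
  ∑ n : Fin N, klDiv (p.trans n (z.1, z.2 n.succ)) (pν.trans n (z.1, z.2 n.succ))

/-- The pathwise KL-regularized objective
`𝔼[∑ₜ γᵗ (R(s_t, a_t⁰) - η ∑_{n=1}^N KL(p^{s_t}_{n-1|n}(· | a_tⁿ) ‖ p^{ν,s_t}_{n-1|n}(· | a_tⁿ)))]`
from the initial state `s`. At each environment step a whole path `a_t^{0:N}` is generated, and the
action executed in the environment is `a_t⁰`. -/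
noncomputable def objective (M : MDP S A) (η : ℝ) (prior : Measure A) [IsProbabilityMeasure prior]
    (N : ℕ) (pν p : DiffusionPolicy S A) (s : S) : EReal :=
  discountedReturn M.γ η (fun z => M.R (z.1, z.2 0)) (p.pathPenalty pν N)
    (trajectoryLaw
      (M.T.comap (fun z : S × (Fin (N + 1) → A) => (z.1, z.2 0))
        (measurable_fst.prodMk ((measurable_pi_apply 0).comp measurable_snd)))
      (p.pathLaw prior N) s)

/-- `p` maximizes the pathwise objective among all diffusion policies, from every initial state. -/
def IsOptimal (M : MDP S A) (η : ℝ) (prior : Measure A) [IsProbabilityMeasure prior]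
    (N : ℕ) (pν p : DiffusionPolicy S A) : Prop :=
  ∀ (p' : DiffusionPolicy S A) (s : S),
    objective M η prior N pν p' s ≤ objective M η prior N pν p s

/-- `pν` is the behavior diffusion process of the policy `ν` for the noising kernels `q`: in every
state it maximizes the evidence lower bound, averaged over `a⁰ ∼ ν(· | s)`, among all diffusion
policies. The averaged negative bound
`𝔼_{a^{0:N} ∼ q^{ν,s}_{0:N}} [log (q_{1:N|0}(a^{1:N} | a⁰) / p^s_{0:N}(a^{0:N}))]` differs from
`KL(q^{ν,s}_{0:N} ‖ p^s_{0:N})` by the entropy of `ν(· | s)`, which does not depend on `p`; the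
divergence is also meaningful if there are no densities. -/
def IsBehaviorDiffusion (q : ℕ → Kernel A A) (ν : Kernel S A) (prior : Measure A) (N : ℕ)
    (pν : DiffusionPolicy S A) : Prop :=
  ∀ (p : DiffusionPolicy S A) (s : S),
    klDiv (forwardLaw q (ν s) N) (pν.pathLaw prior N s) ≤
      klDiv (forwardLaw q (ν s) N) (p.pathLaw prior N s)

end DiffusionPolicy

end Diffusion

end PathwiseKL

/-! Both problems are discounted control problems with a KL penalty relative to a reference kernel.
One generates an action and the other a path, so the core argument allows an arbitrary generated
variable `X`. Let V be a bounded solution of the soft Bellman equation and Q its state-action value.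
Gibbs' variational identity, telescoped over time, shows that every policy earns exactly V(s) minus
η times its expected discounted divergence from the soft policy
(`discountedReturn_eq_sub_policyGap`). Hence V bounds all returns. A policy attaining V(s) agrees
with the soft policy at s, because the time-zero term of the gap already vanishes.

On path space the chain rule turns the summed step penalties into the divergence of path laws
(`klDiv_pathLaw`). The noised law of ν(·|s) ends in the prior, so its time reversal is a diffusion
policy at divergence zero. The minimizer pν therefore has exactly this path law
(`IsBehaviorDiffusion.pathLaw_eq`). The reward sees only a⁰, so the same V solves the pathwise
Bellman equation. The pathwise soft policy is the forward law tilted in a⁰, which is the noised π*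
(`softPolicy_comp_zero`).

Diffusion policies realize only some path laws, but they do realize this one: π*(·|s) ≪ ν(·|s), so
the noised π* also ends in the prior and is generated by its reversal (`pathLaw_reversePolicy`).
Both problems thus attain V, and the a⁰-marginal of the optimal path law is π*. Noising preserves KL
(`klDiv_forwardLaw`). -/

namespace PathwiseKL

/-! ### Kullback–Leibler divergence of kernels: measurability and chain rule -/

section KullbackLeibler

variable {X Y : Type*} [MeasurableSpace X] [MeasurableSpace Y]

/-- Data processing in both directions, along `f` and then along `g`. -/
lemma klDiv_map_of_leftInverse (μ ν : Measure X) [IsFiniteMeasure μ] [IsFiniteMeasure ν]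
    {f : X → Y} {g : Y → X} (hf : Measurable f) (hg : Measurable g)
    (h : Function.LeftInverse g f) : klDiv (μ.map f) (ν.map f) = klDiv μ ν := by
  refine le_antisymm (klDiv_map_le μ ν hf) ?_
  have hmap (ρ : Measure X) : (ρ.map f).map g = ρ := by
    rw [Measure.map_map hg hf, h.comp_eq_id, Measure.map_id]
  simpa only [hmap] using klDiv_map_le (μ.map f) (ν.map f) hg

variable [MeasurableSpace.CountableOrCountablyGenerated X Y]

/-- The kernel derivative is jointly measurable, so in this form the divergence can be integrated
over the base point. -/
lemma klDiv_eq_lintegral_kernel_rnDeriv (κ η : Kernel X Y) [IsFiniteKernel κ] [IsFiniteKernel η]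
    {x : X} (h : κ x ≪ η x) :
    klDiv (κ x) (η x) = ∫⁻ y, ENNReal.ofReal (klFun (κ.rnDeriv η x y).toReal) ∂η x := by
  rw [klDiv_eq_lintegral_klFun_of_ac h]
  refine lintegral_congr_ae ?_
  filter_upwards [Kernel.rnDeriv_eq_rnDeriv_measure (κ := κ) (η := η) (a := x)] with y hy
  rw [hy]

lemma measurable_klFun_rnDeriv (κ η : Kernel X Y) :
    Measurable fun z : X × Y => ENNReal.ofReal (klFun (κ.rnDeriv η z.1 z.2).toReal) := by
  have := Kernel.measurable_rnDeriv κ η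
  fun_prop

lemma measurable_klDiv (κ η : Kernel X Y) [IsFiniteKernel κ] [IsFiniteKernel η] :
    Measurable fun x => klDiv (κ x) (η x) := by
  classical
  have h : (fun x => klDiv (κ x) (η x)) = fun x => if κ x ≪ η x then
      ∫⁻ y, ENNReal.ofReal (klFun (κ.rnDeriv η x y).toReal) ∂η x else ∞ := by
    funext x
    split_ifs with hx
    · exact klDiv_eq_lintegral_kernel_rnDeriv κ η hx
    · exact klDiv_of_not_ac hx
  rw [h]
  exact Measurable.ite (Kernel.measurableSet_absolutelyContinuous κ η)
    (measurable_klFun_rnDeriv κ η).lintegral_kernel_prod_right' measurable_const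

lemma compProd_eq_withDensity_rnDeriv (μ : Measure X) [IsFiniteMeasure μ] (κ η : Kernel X Y)
    [IsFiniteKernel κ] [IsFiniteKernel η] (h : ∀ᵐ x ∂μ, κ x ≪ η x) :
    μ ⊗ₘ κ = (μ ⊗ₘ η).withDensity fun z => κ.rnDeriv η z.1 z.2 := by
  have hm := Kernel.measurable_rnDeriv κ η
  refine Measure.ext_of_lintegral _ fun f hf => ?_
  rw [lintegral_withDensity_eq_lintegral_mul _ hm hf, Measure.lintegral_compProd hf,
    Measure.lintegral_compProd (hm.mul hf)]
  refine lintegral_congr_ae ?_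
  filter_upwards [h] with x hx
  conv_lhs => rw [← Kernel.withDensity_rnDeriv_eq hx]
  rw [Kernel.lintegral_withDensity _ hm _ (by fun_prop)]
  rfl

/-- The chain rule for two composition-products with the same first marginal. -/
lemma klDiv_compProd_right (μ : Measure X) [IsFiniteMeasure μ] (κ η : Kernel X Y)
    [IsFiniteKernel κ] [IsFiniteKernel η] :
    klDiv (μ ⊗ₘ κ) (μ ⊗ₘ η) = ∫⁻ x, klDiv (κ x) (η x) ∂μ := by
  by_cases h : ∀ᵐ x ∂μ, κ x ≪ η x
  · have hm := Kernel.measurable_rnDeriv κ η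
    rw [klDiv_eq_lintegral_klFun_of_ac (Measure.absolutelyContinuous_compProd_right_iff.2 h)]
    have hd : (μ ⊗ₘ κ).rnDeriv (μ ⊗ₘ η) =ᵐ[μ ⊗ₘ η] fun z => κ.rnDeriv η z.1 z.2 := by
      rw [compProd_eq_withDensity_rnDeriv μ κ η h]
      exact Measure.rnDeriv_withDensity _ hm
    calc _ = ∫⁻ z, ENNReal.ofReal (klFun (κ.rnDeriv η z.1 z.2).toReal) ∂(μ ⊗ₘ η) := by
          refine lintegral_congr_ae ?_
          filter_upwards [hd] with z hz
          rw [hz]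
      _ = ∫⁻ x, ∫⁻ y, ENNReal.ofReal (klFun (κ.rnDeriv η x y).toReal) ∂η x ∂μ :=
          Measure.lintegral_compProd (measurable_klFun_rnDeriv κ η)
      _ = _ := by
          refine lintegral_congr_ae ?_
          filter_upwards [h] with x hx
          rw [klDiv_eq_lintegral_kernel_rnDeriv κ η hx]
  -- Here the left side is infinite. A finite right side would make the fibre divergences finite
  -- almost everywhere, which forces absolute continuity.
  · rw [klDiv_of_not_ac (fun h' => h (Measure.absolutelyContinuous_compProd_right_iff.1 h'))]
    symm
    by_contra hne
    refine h ?_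
    filter_upwards [ae_lt_top (measurable_klDiv κ η) hne] with x hx
    exact (klDiv_ne_top_iff.1 hx.ne).1

end KullbackLeibler

/-! ### Log-sum-exp bounds and the Gibbs variational identity -/

section Gibbs

variable {X : Type*} [MeasurableSpace X]

lemma integrable_exp_of_bounded (μ : Measure X) [IsFiniteMeasure μ] {f : X → ℝ}
    (hf : Measurable f) {C : ℝ} (hC : ∀ x, |f x| ≤ C) : Integrable (fun x => Real.exp (f x)) μ := by
  refine Integrable.of_bound (by fun_prop) (Real.exp C) (ae_of_all _ fun x => ?_)
  rw [Real.norm_eq_abs, Real.abs_exp]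
  exact Real.exp_le_exp.2 ((le_abs_self _).trans (hC x))

lemma integrable_of_bounded (μ : Measure X) [IsFiniteMeasure μ] {f : X → ℝ}
    (hf : Measurable f) {C : ℝ} (hC : ∀ x, |f x| ≤ C) : Integrable f μ :=
  Integrable.of_bound hf.aestronglyMeasurable C (ae_of_all _ hC)

lemma abs_integral_le_of_bounded (μ : Measure X) [IsProbabilityMeasure μ] {f : X → ℝ}
    {C : ℝ} (hC : ∀ x, |f x| ≤ C) : |∫ x, f x ∂μ| ≤ C := by
  simpa using norm_integral_le_of_norm_le_const (μ := μ) (f := f) (ae_of_all _ hC)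

/-- The log-sum-exp functional is monotone and commutes with the addition of constants. -/
lemma log_integral_exp_le_add (μ : Measure X) [IsProbabilityMeasure μ] {f g : X → ℝ}
    (hf : Measurable f) (hg : Measurable g) {C C' δ : ℝ} (hC : ∀ x, |f x| ≤ C)
    (hC' : ∀ x, |g x| ≤ C') (hfg : ∀ x, f x ≤ g x + δ) :
    Real.log (∫ x, Real.exp (f x) ∂μ) ≤ Real.log (∫ x, Real.exp (g x) ∂μ) + δ := by
  have hfi := integrable_exp_of_bounded μ hf hC
  have hgi := integrable_exp_of_bounded μ hg hC'
  have hpf := integral_exp_pos hfi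
  have hpg := integral_exp_pos hgi
  rw [← Real.log_exp δ, ← Real.log_mul hpg.ne' (Real.exp_pos δ).ne', ← integral_mul_const]
  refine Real.log_le_log hpf (integral_mono hfi (hgi.mul_const _) fun x => ?_)
  simp only [← Real.exp_add]
  exact Real.exp_le_exp.2 (by simpa using hfg x)

lemma abs_log_integral_exp_sub_le (μ : Measure X) [IsProbabilityMeasure μ] {f g : X → ℝ}
    (hf : Measurable f) (hg : Measurable g) {C C' δ : ℝ} (hC : ∀ x, |f x| ≤ C)
    (hC' : ∀ x, |g x| ≤ C') (hfg : ∀ x, |f x - g x| ≤ δ) :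
    |Real.log (∫ x, Real.exp (f x) ∂μ) - Real.log (∫ x, Real.exp (g x) ∂μ)| ≤ δ := by
  have h₁ := log_integral_exp_le_add μ hf hg hC hC' (δ := δ) fun x => by
    linarith [(abs_le.1 (hfg x)).2]
  have h₂ := log_integral_exp_le_add μ hg hf hC' hC (δ := δ) fun x => by
    linarith [(abs_le.1 (hfg x)).1]
  exact abs_le.2 ⟨by linarith, by linarith⟩

lemma abs_log_integral_exp_le (μ : Measure X) [IsProbabilityMeasure μ] {f : X → ℝ}
    (hf : Measurable f) {C : ℝ} (hC : ∀ x, |f x| ≤ C) :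
    |Real.log (∫ x, Real.exp (f x) ∂μ)| ≤ C := by
  simpa using abs_log_integral_exp_sub_le μ hf (measurable_const (a := (0 : ℝ))) hC
    (C' := 0) (by simp) (by simpa using hC)

/-- The Gibbs variational identity
`KL(μ ‖ ν) + log ∫ exp f dν = KL(μ ‖ ν.tilted f) + ∫ f dμ`, shifted by a constant so that all
terms are nonnegative. -/
lemma klDiv_add_log_integral_exp (μ ν : Measure X) [IsProbabilityMeasure μ]
    [IsProbabilityMeasure ν] {f : X → ℝ} (hf : Measurable f) {C : ℝ} (hC : ∀ x, |f x| ≤ C) :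
    klDiv μ ν + ENNReal.ofReal (Real.log (∫ x, Real.exp (f x) ∂ν) + C) =
      klDiv μ (ν.tilted f) + ENNReal.ofReal (∫ x, f x ∂μ + C) := by
  have hexp := integrable_exp_of_bounded ν hf hC
  have hint := integrable_of_bounded μ hf hC
  have := isProbabilityMeasure_tilted hexp
  by_cases hac : μ ≪ ν
  swap
  · rw [klDiv_of_not_ac hac, klDiv_of_not_ac fun h => hac (h.trans (tilted_absolutelyContinuous ν f))]
    simp
  have hac' : μ ≪ ν.tilted f := hac.trans (absolutelyContinuous_tilted hexp)
  -- The two log-likelihood ratios differ by a bounded function, so both divergences are infinite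
  -- together.
  have hiff : Integrable (llr μ (ν.tilted f)) μ ↔ Integrable (llr μ ν) μ := by
    rw [integrable_congr (llr_tilted_right hac hexp)]
    exact integrable_add_iff_integrable_right' (hint.neg.add (integrable_const _))
  by_cases hllr : Integrable (llr μ ν) μ
  swap
  · rw [klDiv_of_not_integrable hllr, klDiv_of_not_integrable fun h => hllr (hiff.1 h)]
    simp
  have h₁ := toReal_klDiv_of_measure_eq hac (by simp)
  have h₂ := toReal_klDiv_of_measure_eq hac' (by simp)
  rw [integral_llr_tilted_right hac hint hexp hllr] at h₂
  have hl := abs_le.1 (abs_log_integral_exp_le ν hf hC)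
  have hi := abs_le.1 (abs_integral_le_of_bounded μ hC)
  rw [← ENNReal.ofReal_toReal (klDiv_ne_top hac hllr),
    ← ENNReal.ofReal_toReal (klDiv_ne_top hac' (hiff.2 hllr)),
    ← ENNReal.ofReal_add ENNReal.toReal_nonneg (by linarith),
    ← ENNReal.ofReal_add ENNReal.toReal_nonneg (by linarith), h₁, h₂]
  congr 1
  ring

end Gibbs

/-! ### Time marginals of the trajectory and discounted sums -/

section Trajectory

variable {S X : Type*} [MeasurableSpace S] [MeasurableSpace X]

/-- The law of the state `s_t` at time `t`. -/
noncomputable def stateLaw (P : Kernel (S × X) S) (κ : Kernel S X) (s : S) : ℕ → Measure S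
  | 0 => Measure.dirac s
  | t + 1 => P ∘ₘ (stateLaw P κ s t ⊗ₘ κ)

variable (P : Kernel (S × X) S) [IsMarkovKernel P] (κ : Kernel S X) [IsMarkovKernel κ] (s : S)

instance (t : ℕ) : IsProbabilityMeasure (stateLaw P κ s t) := by
  induction t with
  | zero => exact Measure.dirac.isProbabilityMeasure
  | succ t ih => unfold stateLaw; infer_instance

instance : IsProbabilityMeasure (trajectoryLaw P κ s) := by
  unfold trajectoryLaw
  infer_instance

lemma map_trajectoryLaw_zero :
    (trajectoryLaw P κ s).map (fun ω => ω 0) = Measure.dirac s ⊗ₘ κ := by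
  have h : (fun ω : ℕ → S × X => ω 0) =
      (fun h => h ⟨0, Finset.mem_Iic.2 le_rfl⟩) ∘
        (Preorder.frestrictLe (π := fun _ => S × X) 0) := rfl
  rw [trajectoryLaw, Kernel.trajMeasure, h, ← Measure.map_map (by fun_prop) (by fun_prop),
    Measure.map_comp _ _ (by fun_prop), Kernel.traj_map_frestrictLe, Kernel.partialTraj_self,
    Measure.id_comp, Measure.map_map (by fun_prop) (by fun_prop),
    Measure.compProd_eq_comp_prod, Measure.dirac_bind (Kernel.measurable _)]
  exact Measure.map_id

/-- The transition kernel reads only the last entry of the history, so the marginals evolve on their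
own. -/
lemma map_trajectoryLaw_succ (t : ℕ) :
    (trajectoryLaw P κ s).map (fun ω => ω (t + 1)) =
      ((Kernel.id ×ₖ κ) ∘ₖ P) ∘ₘ (trajectoryLaw P κ s).map (fun ω => ω t) := by
  have h := congrArg Measure.snd
    (Kernel.map_frestrictLe_trajMeasure_compProd_eq_map_trajMeasure (X := fun _ => S × X)
      (μ₀ := (Kernel.id ×ₖ κ) s) (κ := fun n => ((Kernel.id ×ₖ κ) ∘ₖ P).comap
        (fun h => h ⟨n, Finset.mem_Iic.2 le_rfl⟩) (measurable_pi_apply _)) (a := t))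
  rw [Measure.snd_compProd, Measure.snd_map_prodMk (by fun_prop)] at h
  rw [trajectoryLaw, ← h, ← Kernel.comp_deterministic_eq_comap, ← Measure.comp_assoc,
    Measure.deterministic_comp_eq_map, Measure.map_map (by fun_prop) (by fun_prop)]
  rfl

/-- The state-action pair at time `t` consists of a state with law `stateLaw t` and of an action
drawn from the policy. -/
lemma map_trajectoryLaw (t : ℕ) :
    (trajectoryLaw P κ s).map (fun ω => ω t) = stateLaw P κ s t ⊗ₘ κ := by
  induction t with
  | zero => exact map_trajectoryLaw_zero P κ s
  | succ t ih =>
    rw [map_trajectoryLaw_succ, ih, ← Measure.comp_assoc, ← Measure.compProd_eq_comp_prod]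
    rfl

lemma lintegral_trajectoryLaw_tsum {γ : ℝ} {c : S × X → ℝ≥0∞} (hc : Measurable c) :
    ∫⁻ ω, ∑' t : ℕ, ENNReal.ofReal γ ^ t * c (ω t) ∂trajectoryLaw P κ s =
      ∑' t : ℕ, ENNReal.ofReal γ ^ t *
        ∫⁻ s', ∫⁻ x, c (s', x) ∂κ s' ∂stateLaw P κ s t := by
  have hct (t : ℕ) : Measurable fun ω : ℕ → S × X => c (ω t) := hc.comp (measurable_pi_apply t)
  rw [lintegral_tsum fun t => ((hct t).const_mul _).aemeasurable]
  refine tsum_congr fun t => ?_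
  rw [lintegral_const_mul _ (hct t), ← Measure.lintegral_compProd hc,
    ← map_trajectoryLaw, lintegral_map hc (measurable_pi_apply t)]

lemma summable_pow_mul_of_bounded {γ : ℝ} (h₀ : 0 ≤ γ) (h₁ : γ < 1) {a : ℕ → ℝ} {C : ℝ}
    (ha : ∀ t, |a t| ≤ C) : Summable fun t => γ ^ t * a t := by
  refine Summable.of_norm_bounded ((summable_geometric_of_lt_one h₀ h₁).mul_right C) fun t => ?_
  rw [Real.norm_eq_abs, abs_mul, abs_of_nonneg (pow_nonneg h₀ t)]
  exact mul_le_mul_of_nonneg_left (ha t) (pow_nonneg h₀ t)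

lemma integral_trajectoryLaw_tsum {γ : ℝ} (h₀ : 0 ≤ γ) (h₁ : γ < 1) {r : S × X → ℝ}
    (hr : Measurable r) {C : ℝ} (hC : ∀ z, |r z| ≤ C) :
    ∫ ω, ∑' t : ℕ, γ ^ t * r (ω t) ∂trajectoryLaw P κ s =
      ∑' t : ℕ, γ ^ t * ∫ z, r z ∂(stateLaw P κ s t ⊗ₘ κ) := by
  have hm (t : ℕ) : Measurable fun ω : ℕ → S × X => γ ^ t * r (ω t) := by fun_prop
  have hb (t : ℕ) (ω : ℕ → S × X) : |γ ^ t * r (ω t)| ≤ γ ^ t * C := by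
    rw [abs_mul, abs_of_nonneg (pow_nonneg h₀ t)]
    exact mul_le_mul_of_nonneg_left (hC _) (pow_nonneg h₀ t)
  rw [← integral_tsum_of_summable_integral_norm
    (fun t => integrable_of_bounded _ (hm t) (hb t))]
  · refine tsum_congr fun t => ?_
    rw [integral_const_mul, ← map_trajectoryLaw,
      integral_map (measurable_pi_apply t).aemeasurable hr.aestronglyMeasurable]
  · refine Summable.of_nonneg_of_le (fun t => integral_nonneg fun ω => norm_nonneg _)
      (fun t => ?_) ((summable_geometric_of_lt_one h₀ h₁).mul_right C)
    exact (le_abs_self _).trans (abs_integral_le_of_bounded _ fun ω => by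
      rw [Real.norm_eq_abs, abs_abs]; exact hb t ω)

end Trajectory

/-! ### Soft values and policies, and the gap formula for the return -/

section SoftOptimality

variable {S X : Type*} [MeasurableSpace S] [MeasurableSpace X]

/-- The state-action value function belonging to the state value function `V`. -/
noncomputable def qValue (P : Kernel (S × X) S) (γ : ℝ) (r : S × X → ℝ) (V : S → ℝ)
    (z : S × X) : ℝ :=
  r z + γ * ∫ s, V s ∂P z

/-- The entropy-regularized maximum `η log ∫ exp (Q(s, x) / η) ν(dx | s)`. -/
noncomputable def softValue (ν : Kernel S X) (η : ℝ) (Q : S × X → ℝ) (s : S) : ℝ :=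
  η * Real.log (∫ x, Real.exp (Q (s, x) / η) ∂ν s)

/-- The policy with density proportional to `exp (Q(s, x) / η)` relative to `ν`. -/
noncomputable def softPolicy (ν : Kernel S X) [IsSFiniteKernel ν] (η : ℝ) (Q : S × X → ℝ) :
    Kernel S X :=
  ν.withDensity fun s x =>
    ENNReal.ofReal (Real.exp (Q (s, x) / η) / ∫ y, Real.exp (Q (s, y) / η) ∂ν s)

lemma measurable_integral_kernel (P : Kernel (S × X) S) [IsMarkovKernel P] {V : S → ℝ}
    (hV : Measurable V) : Measurable fun z => ∫ s, V s ∂P z :=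
  hV.stronglyMeasurable.integral_kernel.measurable

lemma measurable_integral_prod_kernel (κ : Kernel S X) [IsSFiniteKernel κ] {f : S × X → ℝ}
    (hf : Measurable f) : Measurable fun s => ∫ x, f (s, x) ∂κ s :=
  (hf.stronglyMeasurable.integral_kernel_prod_right' (κ := κ)).measurable

lemma measurable_qValue (P : Kernel (S × X) S) [IsMarkovKernel P] (γ : ℝ) {r : S × X → ℝ}
    (hr : Measurable r) {V : S → ℝ} (hV : Measurable V) : Measurable (qValue P γ r V) :=
  hr.add ((measurable_integral_kernel P hV).const_mul γ)

lemma abs_qValue_le (P : Kernel (S × X) S) [IsMarkovKernel P] {γ : ℝ} (hγ : 0 ≤ γ)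
    {r : S × X → ℝ} {V : S → ℝ} {C K : ℝ} (hC : ∀ z, |r z| ≤ C) (hK : ∀ s, |V s| ≤ K)
    (z : S × X) : |qValue P γ r V z| ≤ C + γ * K := by
  refine (abs_add_le _ _).trans (add_le_add (hC z) ?_)
  rw [abs_mul, abs_of_nonneg hγ]
  exact mul_le_mul_of_nonneg_left (abs_integral_le_of_bounded _ hK) hγ

lemma measurable_softValue (ν : Kernel S X) [IsSFiniteKernel ν] (η : ℝ) {Q : S × X → ℝ}
    (hQ : Measurable Q) : Measurable (softValue ν η Q) :=
  ((measurable_integral_prod_kernel ν (f := fun z => Real.exp (Q z / η))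
    (by fun_prop)).log).const_mul η

lemma abs_div_le_div {η : ℝ} (hη : 0 < η) {a b : ℝ} (h : |a| ≤ b) : |a / η| ≤ b / η := by
  rw [abs_div, abs_of_pos hη]
  exact div_le_div_of_nonneg_right h hη.le

lemma abs_softValue_le (ν : Kernel S X) [IsMarkovKernel ν] {η : ℝ} (hη : 0 < η) {Q : S × X → ℝ}
    (hQ : Measurable Q) {K : ℝ} (hK : ∀ z, |Q z| ≤ K) (s : S) : |softValue ν η Q s| ≤ K := by
  have h := abs_log_integral_exp_le (ν s) (f := fun x => Q (s, x) / η) (by fun_prop)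
    fun x => abs_div_le_div hη (hK (s, x))
  rw [softValue, abs_mul, abs_of_pos hη]
  calc _ ≤ η * (K / η) := mul_le_mul_of_nonneg_left h hη.le
    _ = K := mul_div_cancel₀ K hη.ne'

lemma abs_softValue_sub_le (ν : Kernel S X) [IsMarkovKernel ν] {η : ℝ} (hη : 0 < η)
    {Q Q' : S × X → ℝ} (hQ : Measurable Q) (hQ' : Measurable Q') {K K' δ : ℝ}
    (hK : ∀ z, |Q z| ≤ K) (hK' : ∀ z, |Q' z| ≤ K') (hδ : ∀ z, |Q z - Q' z| ≤ δ) (s : S) :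
    |softValue ν η Q s - softValue ν η Q' s| ≤ δ := by
  have h := abs_log_integral_exp_sub_le (ν s) (f := fun x => Q (s, x) / η)
    (g := fun x => Q' (s, x) / η) (by fun_prop) (by fun_prop)
    (fun x => abs_div_le_div hη (hK (s, x))) (fun x => abs_div_le_div hη (hK' (s, x)))
    (δ := δ / η) fun x => by rw [← sub_div]; exact abs_div_le_div hη (hδ (s, x))
  rw [softValue, softValue, ← mul_sub, abs_mul, abs_of_pos hη]
  calc _ ≤ η * (δ / η) := mul_le_mul_of_nonneg_left h hη.le
    _ = δ := mul_div_cancel₀ δ hη.ne'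

lemma softPolicy_apply (ν : Kernel S X) [IsSFiniteKernel ν] (η : ℝ) {Q : S × X → ℝ}
    (hQ : Measurable Q) (s : S) :
    softPolicy ν η Q s = (ν s).tilted fun x => Q (s, x) / η := by
  rw [softPolicy, Kernel.withDensity_apply]
  · rfl
  · have := measurable_integral_prod_kernel ν (f := fun z => Real.exp (Q z / η)) (by fun_prop)
    exact ((((hQ.div_const η).exp).div (this.comp measurable_fst))).ennreal_ofReal

lemma isMarkovKernel_softPolicy (ν : Kernel S X) [IsMarkovKernel ν] {η : ℝ} (hη : 0 < η)
    {Q : S × X → ℝ} (hQ : Measurable Q) {K : ℝ} (hK : ∀ z, |Q z| ≤ K) :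
    IsMarkovKernel (softPolicy ν η Q) := by
  refine ⟨fun s => ?_⟩
  rw [softPolicy_apply ν η hQ]
  exact isProbabilityMeasure_tilted (integrable_exp_of_bounded _ (by fun_prop)
    fun x => abs_div_le_div hη (hK (s, x)))

/-- The Gibbs identity for Q/η, multiplied by η. Adding K keeps the real terms nonnegative, so the
identity holds in `ℝ≥0∞` even when divergences are infinite. -/
lemma klDiv_add_softValue (ν κ : Kernel S X) [IsMarkovKernel ν] [IsMarkovKernel κ] {η : ℝ}
    (hη : 0 < η) {Q : S × X → ℝ} (hQ : Measurable Q) {K : ℝ} (hK : ∀ z, |Q z| ≤ K) (s : S) :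
    ENNReal.ofReal η * klDiv (κ s) (ν s) + ENNReal.ofReal (softValue ν η Q s + K) =
      ENNReal.ofReal η * klDiv (κ s) (softPolicy ν η Q s) +
        ENNReal.ofReal (∫ x, Q (s, x) ∂κ s + K) := by
  have h := congrArg (ENNReal.ofReal η * ·) (klDiv_add_log_integral_exp (κ s) (ν s)
    (f := fun x => Q (s, x) / η) (by fun_prop) fun x => abs_div_le_div hη (hK (s, x)))
  have hmul (a : ℝ) : η * (a / η + K / η) = a + K := by field_simp
  have hlog (a : ℝ) : η * (a + K / η) = η * a + K := by field_simp
  simp only [mul_add, ← ENNReal.ofReal_mul hη.le, integral_div, hmul, hlog] at h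
  rw [softPolicy_apply ν η hQ]
  simpa only [mul_add, ← ENNReal.ofReal_mul hη.le, mul_div_cancel₀ _ hη.ne', softValue] using h

lemma coe_sub_coe_eq_of_add_eq {x y : ℝ≥0∞} {a b : ℝ} (v : ℝ) (ha : 0 ≤ a) (hb : 0 ≤ b)
    (h : x + ENNReal.ofReal a = y + ENNReal.ofReal b) :
    ((b - a + v : ℝ) : EReal) - (x : EReal) = (v : EReal) - (y : EReal) := by
  by_cases hx : x = ∞
  · have hy : y = ∞ := by
      by_contra hy
      rw [hx, top_add] at h
      exact ENNReal.add_ne_top.2 ⟨hy, ENNReal.ofReal_ne_top⟩ h.symm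
    rw [hx, hy]
    simp
  · have hy : y ≠ ∞ := by
      rintro rfl
      rw [top_add] at h
      exact ENNReal.add_ne_top.2 ⟨hx, ENNReal.ofReal_ne_top⟩ h
    have h' := congrArg ENNReal.toReal h
    rw [ENNReal.toReal_add hx ENNReal.ofReal_ne_top, ENNReal.toReal_add hy ENNReal.ofReal_ne_top,
      ENNReal.toReal_ofReal ha, ENNReal.toReal_ofReal hb] at h'
    rw [← EReal.coe_ennreal_toReal hx, ← EReal.coe_ennreal_toReal hy, ← EReal.coe_sub,
      ← EReal.coe_sub]
    congr 1
    linarith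

variable (P : Kernel (S × X) S) (ν κ : Kernel S X) [IsMarkovKernel ν]
  [IsMarkovKernel κ]

/-- The expected discounted sum of the divergences of `κ` from the soft policy. -/
noncomputable def policyGap (γ η : ℝ) (Q : S × X → ℝ) (s : S) : ℝ≥0∞ :=
  ENNReal.ofReal η * ∑' t : ℕ, ENNReal.ofReal γ ^ t *
    ∫⁻ s', klDiv (κ s') (softPolicy ν η Q s') ∂stateLaw P κ s t

/-- The term at time zero suffices: its state law is the Dirac measure at `s`. -/
lemma eq_softPolicy_of_policyGap_eq_zero {γ η : ℝ} (hη : 0 < η)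
    [MeasurableSpace.CountableOrCountablyGenerated S X]
    {Q : S × X → ℝ} (hQ : Measurable Q) {K : ℝ} (hK : ∀ z, |Q z| ≤ K) {s : S}
    (h : policyGap P ν κ γ η Q s = 0) : κ s = softPolicy ν η Q s := by
  have := isMarkovKernel_softPolicy ν hη hQ hK
  have h' := (mul_eq_zero.1 h).resolve_left (by simpa using hη)
  have h₀ := ENNReal.tsum_eq_zero.1 h' 0
  rw [pow_zero, one_mul, stateLaw,
    lintegral_dirac' _ (measurable_klDiv κ (softPolicy ν η Q))] at h₀
  exact klDiv_eq_zero_iff.1 h₀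

lemma policyGap_eq_zero {γ η : ℝ} {Q : S × X → ℝ} (h : ∀ s, κ s = softPolicy ν η Q s) (s : S) :
    policyGap P ν κ γ η Q s = 0 := by
  simp [policyGap, ← h]

variable [IsMarkovKernel P]

/-- Telescoping: r = Q − γPV, and the expectation of PV at time t is that of V at time t + 1. The
shifts by K cancel; they make both series nonnegative for use in `ℝ≥0∞`. -/
lemma tsum_reward_eq {γ : ℝ} (h₀ : 0 ≤ γ) (h₁ : γ < 1) {r : S × X → ℝ} (hr : Measurable r)
    {C : ℝ} (hC : ∀ z, |r z| ≤ C) {V : S → ℝ} (hV : Measurable V) {K : ℝ} (hK : ∀ s, |V s| ≤ K)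
    (hQK : ∀ z, |qValue P γ r V z| ≤ K) (s : S) :
    ∑' t : ℕ, γ ^ t * ∫ z, r z ∂(stateLaw P κ s t ⊗ₘ κ) =
      ∑' t : ℕ, γ ^ t * (∫ z, qValue P γ r V z ∂(stateLaw P κ s t ⊗ₘ κ) + K) -
        ∑' t : ℕ, γ ^ t * (∫ s', V s' ∂stateLaw P κ s t + K) + V s := by
  have hQ := measurable_qValue P γ hr hV
  have hPV := measurable_integral_kernel P hV
  have hstep (t : ℕ) : ∫ z, r z ∂(stateLaw P κ s t ⊗ₘ κ) =
      ∫ z, qValue P γ r V z ∂(stateLaw P κ s t ⊗ₘ κ) - γ * ∫ s', V s' ∂stateLaw P κ s (t + 1) := by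
    have hV' : ∫ s', V s' ∂stateLaw P κ s (t + 1) =
        ∫ z, ∫ s', V s' ∂P z ∂(stateLaw P κ s t ⊗ₘ κ) := by
      have hi := integrable_of_bounded (stateLaw P κ s (t + 1)) hV hK
      rw [stateLaw, Measure.comp_eq_comp_const_apply] at hi ⊢
      rw [Kernel.integral_comp hi, Kernel.const_apply]
    have hadd := integral_add (integrable_of_bounded (stateLaw P κ s t ⊗ₘ κ) hr hC)
      ((integrable_of_bounded (stateLaw P κ s t ⊗ₘ κ) hPV
        fun z => abs_integral_le_of_bounded _ hK).const_mul γ)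
    rw [integral_const_mul] at hadd
    rw [hV', show (∫ z, qValue P γ r V z ∂(stateLaw P κ s t ⊗ₘ κ)) = _ from hadd]
    ring
  have hbV (t : ℕ) : |∫ s', V s' ∂stateLaw P κ s t| ≤ K := abs_integral_le_of_bounded _ hK
  have hbQ (t : ℕ) : |∫ z, qValue P γ r V z ∂(stateLaw P κ s t ⊗ₘ κ)| ≤ K :=
    abs_integral_le_of_bounded _ hQK
  have hsV := summable_pow_mul_of_bounded h₀ h₁ hbV
  have hsQ := summable_pow_mul_of_bounded h₀ h₁ hbQ
  have hsK := (summable_geometric_of_lt_one h₀ h₁).mul_right K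
  have hzero : ∫ s', V s' ∂stateLaw P κ s 0 = V s :=
    integral_dirac' _ _ hV.stronglyMeasurable
  have hshift := hsV.tsum_eq_zero_add
  rw [hzero, pow_zero, one_mul] at hshift
  have hsV' := (summable_nat_add_iff 1).2 hsV
  simp only [mul_add]
  rw [hsQ.tsum_add hsK, hsV.tsum_add hsK, hshift]
  calc _ = ∑' t : ℕ, (γ ^ t * ∫ z, qValue P γ r V z ∂(stateLaw P κ s t ⊗ₘ κ) -
        γ ^ (t + 1) * ∫ s', V s' ∂stateLaw P κ s (t + 1)) :=
        tsum_congr fun t => by rw [hstep t]; ring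
    _ = _ := by rw [hsQ.tsum_sub hsV']; ring

/-- If `V` solves the soft Bellman equation, then the return of every policy is `V` minus the
discounted divergence of the policy from the soft policy. -/
theorem discountedReturn_eq_sub_policyGap [MeasurableSpace.CountableOrCountablyGenerated S X]
    {γ η : ℝ} (h₀ : 0 ≤ γ) (h₁ : γ < 1) (hη : 0 < η)
    {r : S × X → ℝ} (hr : Measurable r) {C : ℝ} (hC : ∀ z, |r z| ≤ C) {V : S → ℝ}
    (hV : Measurable V) {C' : ℝ} (hC' : ∀ s, |V s| ≤ C')
    (hfix : ∀ s, softValue ν η (qValue P γ r V) s = V s) {c : S × X → ℝ≥0∞} (hc : Measurable c)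
    (hcost : ∀ s, ∫⁻ x, c (s, x) ∂κ s = klDiv (κ s) (ν s)) (s : S) :
    discountedReturn γ η r c (trajectoryLaw P κ s) =
      (V s : EReal) - (policyGap P ν κ γ η (qValue P γ r V) s : EReal) := by
  set Q := qValue P γ r V
  have hQ : Measurable Q := measurable_qValue P γ hr hV
  set K := C + γ * C'
  have hQK : ∀ z, |Q z| ≤ K := abs_qValue_le P h₀ hC hC'
  -- As a soft value of Q, V inherits the bound on Q, so a single shift K serves both.
  have hVK (s : S) : |V s| ≤ K := hfix s ▸ abs_softValue_le ν hη hQ hQK s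
  have := isMarkovKernel_softPolicy ν hη hQ hQK
  have hm := measurable_klDiv κ ν
  have hm' := measurable_klDiv κ (softPolicy ν η Q)
  have hmG := measurable_integral_prod_kernel κ hQ
  have hG (s : S) : |∫ x, Q (s, x) ∂κ s| ≤ K := abs_integral_le_of_bounded _ fun x => hQK (s, x)
  have hofReal (μ : Measure S) [IsProbabilityMeasure μ] {g : S → ℝ} (hg : Measurable g)
      (hgK : ∀ s, |g s| ≤ K) :
      ∫⁻ s, ENNReal.ofReal (g s + K) ∂μ = ENNReal.ofReal (∫ s, g s ∂μ + K) := by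
    have hgi := integrable_of_bounded μ hg hgK
    have hadd : ∫ s, g s + K ∂μ = ∫ s, g s ∂μ + K := by
      rw [integral_add hgi (integrable_const K)]
      simp
    have hi : Integrable (fun s => g s + K) μ := hgi.add (integrable_const K)
    rw [← hadd, ofReal_integral_eq_lintegral_ofReal hi]
    · exact ae_of_all _ fun s => show 0 ≤ g s + K by linarith [(abs_le.1 (hgK s)).1]
  have hterm (t : ℕ) :
      ENNReal.ofReal η * ∫⁻ s', klDiv (κ s') (ν s') ∂stateLaw P κ s t +
        ENNReal.ofReal (∫ s', V s' ∂stateLaw P κ s t + K) =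
      ENNReal.ofReal η * ∫⁻ s', klDiv (κ s') (softPolicy ν η Q s') ∂stateLaw P κ s t +
        ENNReal.ofReal (∫ z, Q z ∂(stateLaw P κ s t ⊗ₘ κ) + K) := by
    rw [Measure.integral_compProd (integrable_of_bounded _ hQ hQK), ← hofReal _ hV hVK,
      ← hofReal _ hmG hG, ← lintegral_const_mul _ hm, ← lintegral_const_mul _ hm',
      ← lintegral_add_left (hm.const_mul _), ← lintegral_add_left (hm'.const_mul _)]
    refine lintegral_congr fun s' => ?_
    rw [← klDiv_add_softValue ν κ hη hQ hQK s', hfix s']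
  have hsum {a : ℕ → ℝ} (ha : ∀ t, |a t| ≤ K) :
      ∑' t, ENNReal.ofReal γ ^ t * ENNReal.ofReal (a t + K) =
        ENNReal.ofReal (∑' t, γ ^ t * (a t + K)) := by
    have hnn (t : ℕ) : 0 ≤ a t + K := by linarith [(abs_le.1 (ha t)).1]
    rw [ENNReal.ofReal_tsum_of_nonneg fun t => mul_nonneg (pow_nonneg h₀ t) (hnn t)]
    · exact tsum_congr fun t => by
        rw [ENNReal.ofReal_mul (pow_nonneg h₀ t), ENNReal.ofReal_pow h₀]
    · exact summable_pow_mul_of_bounded h₀ h₁ (C := K + K) fun t => by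
        rw [abs_of_nonneg (hnn t)]; linarith [(abs_le.1 (ha t)).2]
  have hbV (t : ℕ) : |∫ s', V s' ∂stateLaw P κ s t| ≤ K := abs_integral_le_of_bounded _ hVK
  have hbQ (t : ℕ) : |∫ z, Q z ∂(stateLaw P κ s t ⊗ₘ κ)| ≤ K := abs_integral_le_of_bounded _ hQK
  rw [discountedReturn, integral_trajectoryLaw_tsum P κ s h₀ h₁ hr hC,
    lintegral_trajectoryLaw_tsum P κ s hc, tsum_reward_eq P κ h₀ h₁ hr hC hV hVK hQK]
  simp only [hcost]
  refine coe_sub_coe_eq_of_add_eq (V s) ?_ ?_ ?_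
  · exact tsum_nonneg fun t => mul_nonneg (pow_nonneg h₀ t) (by linarith [(abs_le.1 (hbV t)).1])
  · exact tsum_nonneg fun t => mul_nonneg (pow_nonneg h₀ t) (by linarith [(abs_le.1 (hbQ t)).1])
  · rw [← hsum hbV, ← hsum hbQ, policyGap, ← ENNReal.tsum_mul_left, ← ENNReal.tsum_mul_left,
      ← ENNReal.tsum_add, ← ENNReal.tsum_add]
    refine tsum_congr fun t => ?_
    have h := congrArg (ENNReal.ofReal γ ^ t * ·) (hterm t)
    simp only [mul_add] at h
    rw [mul_left_comm, h, mul_left_comm]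

end SoftOptimality

/-! ### Solving the soft Bellman equation by value iteration -/

section SoftBellman

variable {S X : Type*} [MeasurableSpace S] [MeasurableSpace X]
  (P : Kernel (S × X) S) [IsMarkovKernel P] (ν : Kernel S X) [IsMarkovKernel ν]

/-- Value iteration for the soft Bellman equation, started at zero. -/
noncomputable def softValueIterate (γ η : ℝ) (r : S × X → ℝ) : ℕ → S → ℝ
  | 0 => 0
  | n + 1 => softValue ν η (qValue P γ r (softValueIterate γ η r n))

/-- The soft maximum is nonexpansive in the sup norm and the discounted expectation contracts by γ.
-/
lemma abs_softValue_qValue_sub_le {γ η : ℝ} (h₀ : 0 ≤ γ) (hη : 0 < η) {r : S × X → ℝ}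
    (hr : Measurable r) {C : ℝ} (hC : ∀ z, |r z| ≤ C) {U V : S → ℝ} (hU : Measurable U)
    (hV : Measurable V) {K δ : ℝ} (hUK : ∀ s, |U s| ≤ K) (hVK : ∀ s, |V s| ≤ K)
    (hδ : ∀ s, |U s - V s| ≤ δ) (s : S) :
    |softValue ν η (qValue P γ r U) s - softValue ν η (qValue P γ r V) s| ≤ γ * δ := by
  refine abs_softValue_sub_le ν hη (measurable_qValue P γ hr hU) (measurable_qValue P γ hr hV)
    (abs_qValue_le P h₀ hC hUK) (abs_qValue_le P h₀ hC hVK) (fun z => ?_) s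
  have h : qValue P γ r U z - qValue P γ r V z = γ * ∫ s, U s - V s ∂P z := by
    rw [integral_sub (integrable_of_bounded _ hU hUK) (integrable_of_bounded _ hV hVK), qValue,
      qValue]
    ring
  rw [h, abs_mul, abs_of_nonneg h₀]
  exact mul_le_mul_of_nonneg_left (abs_integral_le_of_bounded _ hδ) h₀

/-- The soft Bellman equation has a bounded measurable solution. -/
theorem exists_softValue_qValue_eq {γ η : ℝ} (h₀ : 0 ≤ γ) (h₁ : γ < 1) (hη : 0 < η)
    {r : S × X → ℝ} (hr : Measurable r) {C : ℝ} (hC : ∀ z, |r z| ≤ C) :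
    ∃ V : S → ℝ, Measurable V ∧ (∃ K, ∀ s, |V s| ≤ K) ∧
      ∀ s, softValue ν η (qValue P γ r V) s = V s := by
  set v := softValueIterate P ν γ η r with hv
  have hsucc (n : ℕ) : v (n + 1) = softValue ν η (qValue P γ r (v n)) := rfl
  have hpos : 0 < 1 - γ := by linarith
  have hm (n : ℕ) : Measurable (v n) := by
    cases n with
    | zero => exact measurable_const
    | succ n =>
      rw [hsucc]
      induction n with
      | zero => exact measurable_softValue ν η (measurable_qValue P γ hr measurable_const)
      | succ n ih => exact measurable_softValue ν η (measurable_qValue P γ hr ih)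
  -- The bound `C` is known to be nonnegative only once S × X has a point.
  rcases isEmpty_or_nonempty S with hS | ⟨⟨s₀⟩⟩
  · exact ⟨0, measurable_const, ⟨0, fun s => isEmptyElim s⟩, fun s => isEmptyElim s⟩
  have hC₀ : 0 ≤ C := by
    obtain ⟨x⟩ := nonempty_of_isProbabilityMeasure (ν s₀)
    exact (abs_nonneg _).trans (hC (s₀, x))
  -- The fixed point of K ↦ C + γK, hence a bound preserved by the iteration.
  set K := C / (1 - γ) with hKdef
  have hK : C + γ * K = K := by
    rw [hKdef]
    field_simp
    ring
  have hb (n : ℕ) (s : S) : |v n s| ≤ K := by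
    induction n generalizing s with
    | zero => simpa [hv, softValueIterate] using div_nonneg hC₀ hpos.le
    | succ n ih =>
      rw [hsucc, ← hK]
      exact abs_softValue_le ν hη (measurable_qValue P γ hr (hm n)) (abs_qValue_le P h₀ hC ih) s
  have hdist (n : ℕ) (s : S) : |v n s - v (n + 1) s| ≤ C * γ ^ n := by
    induction n generalizing s with
    | zero =>
      have h := abs_softValue_le ν hη (measurable_qValue P γ hr (hm 0))
        (abs_qValue_le P h₀ hC (V := v 0) (K := 0) fun s => by simp [hv, softValueIterate]) s
      simpa [hv, softValueIterate] using h
    | succ n ih =>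
      have h := abs_softValue_qValue_sub_le P ν h₀ hη hr hC (hm n) (hm (n + 1)) (hb n) (hb (n + 1))
        ih s
      rw [hsucc n, hsucc (n + 1), pow_succ]
      calc _ ≤ γ * (C * γ ^ n) := h
        _ = _ := by ring
  have hlim (s : S) : ∃ l, Tendsto (fun n => v n s) atTop (nhds l) :=
    cauchySeq_tendsto_of_complete (cauchySeq_of_le_geometric γ C h₁ fun n => hdist n s)
  choose V hV using hlim
  have hVm : Measurable V := measurable_of_tendsto_metrizable hm (tendsto_pi_nhds.2 hV)
  have hVK (s : S) : |V s| ≤ K := le_of_tendsto (hV s).abs (Eventually.of_forall fun n => hb n s)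
  refine ⟨V, hVm, ⟨K, hVK⟩, fun s => ?_⟩
  have hrate (n : ℕ) (s : S) : |v n s - V s| ≤ C * γ ^ n / (1 - γ) :=
    dist_le_of_le_geometric_of_tendsto γ C h₁ (fun n => hdist n s) (hV s) n
  have hFV : Tendsto (fun n => v (n + 1) s) atTop (nhds (softValue ν η (qValue P γ r V) s)) := by
    rw [tendsto_iff_dist_tendsto_zero]
    have hz : Tendsto (fun n => γ * (C * γ ^ n / (1 - γ))) atTop (nhds 0) := by
      simpa using (((tendsto_pow_atTop_nhds_zero_of_lt_one h₀ h₁).const_mul C).div_const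
        (1 - γ)).const_mul γ
    exact squeeze_zero (fun n => dist_nonneg) (fun n =>
      abs_softValue_qValue_sub_le P ν h₀ hη hr hC (hm n) hVm (hb n) hVK (hrate n) s) hz
  exact tendsto_nhds_unique hFV ((tendsto_add_atTop_iff_nat 1).2 (hV s))

end SoftBellman

/-! ### The forward noising chain -/

section Forward

variable {A : Type*} [MeasurableSpace A] (q : ℕ → Kernel A A)

lemma lintegral_forwardLaw_zero (ρ : Measure A) {f : (Fin 1 → A) → ℝ≥0∞} (hf : Measurable f) :
    ∫⁻ w, f w ∂forwardLaw q ρ 0 = ∫⁻ a, f (fun _ => a) ∂ρ :=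
  lintegral_map hf (by fun_prop)

variable [∀ n, IsMarkovKernel (q n)]

instance isProbabilityMeasure_forwardLaw (ρ : Measure A) [IsProbabilityMeasure ρ] (n : ℕ) :
    IsProbabilityMeasure (forwardLaw q ρ n) := by
  induction n with
  | zero => exact Measure.isProbabilityMeasure_map (by fun_prop)
  | succ n ih => exact Measure.isProbabilityMeasure_map (measurable_snoc (n + 1)).aemeasurable

instance sFinite_forwardLaw (ρ : Measure A) [SFinite ρ] (n : ℕ) : SFinite (forwardLaw q ρ n) := by
  cases n <;> (unfold forwardLaw; infer_instance)

lemma lintegral_forwardLaw_succ (ρ : Measure A) [SFinite ρ] (n : ℕ)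
    {f : (Fin (n + 2) → A) → ℝ≥0∞} (hf : Measurable f) :
    ∫⁻ w, f w ∂forwardLaw q ρ (n + 1) =
      ∫⁻ w, ∫⁻ a, f (Fin.snoc w a) ∂q n (w (Fin.last n)) ∂forwardLaw q ρ n := by
  rw [forwardLaw, lintegral_map hf (measurable_snoc (n + 1)),
    Measure.lintegral_compProd (f := fun z => f (Fin.snoc z.1 z.2))
      (hf.comp (measurable_snoc (n + 1)))]
  rfl

lemma measurable_lintegral_forward_step (n : ℕ) {f : (Fin (n + 2) → A) → ℝ≥0∞}
    (hf : Measurable f) :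
    Measurable fun w : Fin (n + 1) → A =>
      ∫⁻ a, f (Fin.snoc w a) ∂q n (w (Fin.last n)) :=
  (hf.comp (measurable_snoc (n + 1))).lintegral_kernel_prod_right'
    (κ := (q n).comap (fun w : Fin (n + 1) → A => w (Fin.last n)) (measurable_pi_apply _))

lemma map_zero_forwardLaw (ρ : Measure A) [SFinite ρ] (n : ℕ) :
    (forwardLaw q ρ n).map (fun w => w 0) = ρ := by
  refine Measure.ext_of_lintegral _ fun f hf => ?_
  rw [lintegral_map hf (measurable_pi_apply 0)]
  induction n with
  | zero => exact lintegral_forwardLaw_zero q ρ (hf.comp (measurable_pi_apply 0))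
  | succ n ih =>
    rw [lintegral_forwardLaw_succ q ρ n (f := fun w => f (w 0))
      (hf.comp (measurable_pi_apply 0)), ← ih]
    refine lintegral_congr fun w => ?_
    have h (a : A) : (Fin.snoc w a : Fin (n + 2) → A) 0 = w 0 := by
      rw [← Fin.castSucc_zero, Fin.snoc_castSucc]
    simp only [h, lintegral_const, measure_univ, mul_one]

/-- Noising never alters the coordinate a⁰, so a density in a⁰ factors out of every later integral.
-/
lemma forwardLaw_withDensity (ρ : Measure A) [SFinite ρ] {g : A → ℝ≥0∞} (hg : Measurable g)
    (n : ℕ) :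
    forwardLaw q (ρ.withDensity g) n = (forwardLaw q ρ n).withDensity fun w => g (w 0) := by
  have hg₀ (n : ℕ) : Measurable fun w : Fin (n + 1) → A => g (w 0) :=
    hg.comp (measurable_pi_apply 0)
  refine Measure.ext_of_lintegral _ fun f hf => ?_
  rw [lintegral_withDensity_eq_lintegral_mul _ (hg₀ n) hf]
  induction n with
  | zero =>
    have hf' : Measurable fun a : A => f fun _ => a := by fun_prop
    rw [lintegral_forwardLaw_zero q _ hf, lintegral_forwardLaw_zero q _ ((hg₀ 0).mul hf),
      lintegral_withDensity_eq_lintegral_mul _ hg hf']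
    rfl
  | succ n ih =>
    rw [lintegral_forwardLaw_succ q _ n hf, ih _ (measurable_lintegral_forward_step q n hf),
      lintegral_forwardLaw_succ q _ n ((hg₀ (n + 1)).mul hf)]
    refine lintegral_congr fun w => ?_
    have h (a : A) : (Fin.snoc w a : Fin (n + 2) → A) 0 = w 0 := by
      rw [← Fin.castSucc_zero, Fin.snoc_castSucc]
    have hfw : Measurable fun a => f (Fin.snoc w a) :=
      hf.comp ((measurable_snoc (n + 1)).comp measurable_prodMk_left)
    simp only [Pi.mul_apply, h]
    rw [lintegral_const_mul _ hfw]

lemma forwardLaw_tilted (ρ : Measure A) [SFinite ρ] {f : A → ℝ} (hf : Measurable f) (n : ℕ) :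
    forwardLaw q (ρ.tilted f) n = (forwardLaw q ρ n).tilted fun w => f (w 0) := by
  rw [Measure.tilted, forwardLaw_withDensity q ρ (by fun_prop), Measure.tilted]
  have h : ∫ a, Real.exp (f a) ∂ρ = ∫ w, Real.exp (f (w 0)) ∂forwardLaw q ρ n := by
    conv_lhs => rw [← map_zero_forwardLaw q ρ n]
    exact integral_map (measurable_pi_apply 0).aemeasurable (by fun_prop)
  rw [h]

variable {S : Type*} [MeasurableSpace S]

lemma measurable_lintegral_forwardLaw (ρ : Kernel S A) [IsMarkovKernel ρ] (n : ℕ)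
    {f : (Fin (n + 1) → A) → ℝ≥0∞} (hf : Measurable f) :
    Measurable fun s => ∫⁻ w, f w ∂forwardLaw q (ρ s) n := by
  induction n with
  | zero =>
    simp only [lintegral_forwardLaw_zero q _ hf]
    have hf' : Measurable fun a : A => f fun _ => a := by fun_prop
    exact hf'.lintegral_kernel
  | succ n ih =>
    simp only [lintegral_forwardLaw_succ q _ n hf]
    exact ih (measurable_lintegral_forward_step q n hf)

/-- The laws `forwardLaw q (ρ s) n` as a kernel in `s`. -/
noncomputable def forwardKernel (ρ : Kernel S A) [IsMarkovKernel ρ] (n : ℕ) :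
    Kernel S (Fin (n + 1) → A) where
  toFun s := forwardLaw q (ρ s) n
  measurable' := by
    refine Measure.measurable_of_measurable_coe _ fun t ht => ?_
    simp only [← lintegral_indicator_one ht]
    exact measurable_lintegral_forwardLaw q ρ n (measurable_one.indicator ht)

lemma forwardKernel_apply (ρ : Kernel S A) [IsMarkovKernel ρ] (n : ℕ) (s : S) :
    forwardKernel q ρ n s = forwardLaw q (ρ s) n := rfl

instance (ρ : Kernel S A) [IsMarkovKernel ρ] (n : ℕ) : IsMarkovKernel (forwardKernel q ρ n) :=
  ⟨fun s => isProbabilityMeasure_forwardLaw q (ρ s) n⟩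

end Forward

/-! ### Divergence of mixtures with identifiable components -/

section Mixture

variable {Y W : Type*} [MeasurableSpace Y] [MeasurableSpace W]

/-- Each component lives on its own fibre of `g`, so the outcome reveals the index and the mixture
carries the whole joint law. -/
lemma compProd_eq_map_comp_of_section (μ : Measure Y) [SFinite μ] (κ : Kernel Y W)
    [IsSFiniteKernel κ] {g : W → Y} (hg : Measurable g) (hκ : ∀ y, ∀ᵐ w ∂κ y, g w = y) :
    μ ⊗ₘ κ = (κ ∘ₘ μ).map fun w => (g w, w) := by
  have hm : Measurable fun w => (g w, w) := hg.prodMk measurable_id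
  refine Measure.ext_of_lintegral _ fun f hf => ?_
  have hfm : Measurable fun w => f (g w, w) := hf.comp hm
  rw [Measure.lintegral_compProd hf, lintegral_map hf hm,
    Measure.lintegral_bind κ.aemeasurable hfm.aemeasurable]
  refine lintegral_congr fun y => lintegral_congr_ae ?_
  filter_upwards [hκ y] with w hw
  rw [hw]

/-- The chain rule for mixtures whose components can be told apart. -/
lemma klDiv_comp_of_section [MeasurableSpace.CountableOrCountablyGenerated Y W]
    (μ μ' : Measure Y) [IsFiniteMeasure μ] [IsFiniteMeasure μ'] (κ κ' : Kernel Y W)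
    [IsMarkovKernel κ] [IsMarkovKernel κ'] {g : W → Y} (hg : Measurable g)
    (hκ : ∀ y, ∀ᵐ w ∂κ y, g w = y) (hκ' : ∀ y, ∀ᵐ w ∂κ' y, g w = y) :
    klDiv (κ ∘ₘ μ) (κ' ∘ₘ μ') = klDiv μ μ' + ∫⁻ y, klDiv (κ y) (κ' y) ∂μ := by
  have hm : Measurable fun w => (g w, w) := hg.prodMk measurable_id
  rw [← klDiv_compProd_right, ← klDiv_compProd_eq_add,
    compProd_eq_map_comp_of_section μ κ hg hκ, compProd_eq_map_comp_of_section μ' κ' hg hκ',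
    klDiv_map_of_leftInverse _ _ hm measurable_snd fun _ => rfl]

end Mixture

/-! ### Reverse chains and their pathwise divergence -/

namespace DiffusionPolicy

variable {S A : Type*} [MeasurableSpace S] [MeasurableSpace A]

lemma measurable_snoc_right (n : ℕ) (x : A) :
    Measurable fun w : Fin (n + 1) → A => (Fin.snoc w x : Fin (n + 2) → A) :=
  (measurable_snoc (n + 1)).comp measurable_prodMk_right

variable (p p' : DiffusionPolicy S A)

lemma lintegral_pathFrom_zero (z : S × A) {f : (Fin 1 → A) → ℝ≥0∞} (hf : Measurable f) :
    ∫⁻ w, f w ∂p.pathFrom 0 z = f fun _ => z.2 :=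
  Kernel.lintegral_deterministic' _ hf

/-- The reverse chain started in state `s`, as a kernel in its starting point only. -/
noncomputable def pathFromState (n : ℕ) (s : S) : Kernel A (Fin (n + 1) → A) :=
  (p.pathFrom n).comap (Prod.mk s) measurable_prodMk_left

instance (n : ℕ) (s : S) : IsMarkovKernel (p.pathFromState n s) := by
  unfold pathFromState
  infer_instance

/-- With the endpoint fixed, appending it is injective with inverse `Fin.init`, so the divergence
ignores this map. -/
lemma pathFrom_succ_apply (n : ℕ) (s : S) (x : A) :
    p.pathFrom (n + 1) (s, x) =
      (p.pathFromState n s ∘ₘ p.trans n (s, x)).map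
        fun w => (Fin.snoc w x : Fin (n + 2) → A) := by
  have hs := measurable_snoc (A := A) (n + 1)
  have hx := measurable_snoc_right n x
  refine Measure.ext_of_lintegral _ fun f hf => ?_
  have hfs : Measurable fun z : (Fin (n + 1) → A) × A => f (Fin.snoc z.1 z.2) := hf.comp hs
  have hfx : Measurable fun w : Fin (n + 1) → A => f (Fin.snoc w x) := hf.comp hx
  rw [pathFrom, Kernel.lintegral_map _ hs _ hf, Kernel.lintegral_prod_deterministic _ _ _ hfs,
    Kernel.lintegral_comp _ _ _ hfx,
    Kernel.lintegral_deterministic_prod _ _ _ hfx.lintegral_kernel,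
    lintegral_map hf hx, Measure.lintegral_bind (Kernel.aemeasurable _) hfx.aemeasurable]
  rfl

lemma lintegral_pathFrom_succ (n : ℕ) (s : S) (x : A) {f : (Fin (n + 2) → A) → ℝ≥0∞}
    (hf : Measurable f) :
    ∫⁻ w, f w ∂p.pathFrom (n + 1) (s, x) =
      ∫⁻ y, ∫⁻ w, f (Fin.snoc w x) ∂p.pathFrom n (s, y) ∂p.trans n (s, x) := by
  have hx := measurable_snoc_right n x
  have hfx : Measurable fun w : Fin (n + 1) → A => f (Fin.snoc w x) := hf.comp hx
  rw [pathFrom_succ_apply, lintegral_map hf hx,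
    Measure.lintegral_bind (Kernel.aemeasurable _) hfx.aemeasurable]
  rfl

lemma pathLaw_apply (prior : Measure A) [SFinite prior] (n : ℕ) (s : S) :
    p.pathLaw prior n s = p.pathFromState n s ∘ₘ prior := by
  refine Measure.ext_of_lintegral _ fun f hf => ?_
  rw [pathLaw, Kernel.lintegral_comp _ _ _ hf, Kernel.lintegral_id_prod hf.lintegral_kernel,
    Kernel.const_apply, Measure.lintegral_bind (Kernel.aemeasurable _) hf.aemeasurable]
  rfl

lemma measurable_pathPenalty [StandardBorelSpace A] (n : ℕ) :
    Measurable (p.pathPenalty p' n) := by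
  unfold pathPenalty
  refine Finset.measurable_sum _ fun i _ => ?_
  exact (measurable_klDiv (p.trans i) (p'.trans i)).comp
    (measurable_fst.prodMk ((measurable_pi_apply i.succ).comp measurable_snd))

lemma pathPenalty_snoc (n : ℕ) (s : S) (w : Fin (n + 1) → A) (x : A) :
    p.pathPenalty p' (n + 1) (s, Fin.snoc w x) =
      p.pathPenalty p' n (s, w) + klDiv (p.trans n (s, x)) (p'.trans n (s, x)) := by
  simp only [pathPenalty]
  rw [Fin.sum_univ_castSucc]
  congr 1
  · refine Finset.sum_congr rfl fun i _ => ?_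
    rw [Fin.succ_castSucc, Fin.snoc_castSucc, Fin.val_castSucc]
  · rw [Fin.succ_last, Fin.snoc_last, Fin.val_last]

variable [StandardBorelSpace A]

lemma ae_pathFrom_last (n : ℕ) (s : S) (x : A) :
    ∀ᵐ w ∂p.pathFrom n (s, x), w (Fin.last n) = x := by
  have hm (n : ℕ) : MeasurableSet {w : Fin (n + 1) → A | w (Fin.last n) = x} :=
    measurableSet_eq_fun (measurable_pi_apply _) measurable_const
  cases n with
  | zero => exact (ae_dirac_iff (hm 0)).2 rfl
  | succ n =>
    rw [pathFrom_succ_apply, ae_map_iff (measurable_snoc_right n x).aemeasurable (hm (n + 1))]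
    exact ae_of_all _ fun w => by simp

/-- A path reveals its starting point as its last coordinate, so mixtures over starting points have
identifiable components. -/
lemma klDiv_comp_pathFromState (μ μ' : Measure A) [IsFiniteMeasure μ] [IsFiniteMeasure μ'] (n : ℕ)
    (s : S) :
    klDiv (p.pathFromState n s ∘ₘ μ) (p'.pathFromState n s ∘ₘ μ') =
      klDiv μ μ' + ∫⁻ y, klDiv (p.pathFrom n (s, y)) (p'.pathFrom n (s, y)) ∂μ :=
  klDiv_comp_of_section μ μ' (p.pathFromState n s) (p'.pathFromState n s)
    (g := fun w => w (Fin.last n)) (measurable_pi_apply _) (ae_pathFrom_last p n s)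
    (ae_pathFrom_last p' n s)

/-- The chain rule for the reverse chain. -/
lemma klDiv_pathFrom (n : ℕ) (s : S) (x : A) :
    klDiv (p.pathFrom n (s, x)) (p'.pathFrom n (s, x)) =
      ∫⁻ w, p.pathPenalty p' n (s, w) ∂p.pathFrom n (s, x) := by
  have hm (n : ℕ) : Measurable fun w => p.pathPenalty p' n (s, w) :=
    (measurable_pathPenalty p p' n).comp measurable_prodMk_left
  induction n generalizing x with
  | zero =>
    -- With no reverse steps both laws are the Dirac measure at the constant path.
    have h : p.pathFrom 0 (s, x) = p'.pathFrom 0 (s, x) := rfl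
    rw [h, klDiv_self]
    simp [pathPenalty]
  | succ n ih =>
    have hinit : Measurable (Fin.init : (Fin (n + 2) → A) → Fin (n + 1) → A) :=
      measurable_pi_lambda _ fun i => measurable_pi_apply i.castSucc
    rw [lintegral_pathFrom_succ p n s x (hm (n + 1)), pathFrom_succ_apply, pathFrom_succ_apply,
      klDiv_map_of_leftInverse _ _ (measurable_snoc_right n x) hinit
        fun w => Fin.init_snoc (α := fun _ => A) x w,
      klDiv_comp_pathFromState]
    simp only [pathPenalty_snoc]
    simp only [lintegral_add_right _ measurable_const, lintegral_const, measure_univ, mul_one]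
    rw [add_comm]
    congr 1
    exact lintegral_congr fun y => ih y

/-- The divergence of the path laws is the expected accumulated penalty. -/
lemma klDiv_pathLaw (prior : Measure A) [IsProbabilityMeasure prior] (n : ℕ) (s : S) :
    klDiv (p.pathLaw prior n s) (p'.pathLaw prior n s) =
      ∫⁻ w, p.pathPenalty p' n (s, w) ∂p.pathLaw prior n s := by
  have hm : Measurable fun w => p.pathPenalty p' n (s, w) :=
    (measurable_pathPenalty p p' n).comp measurable_prodMk_left
  rw [pathLaw_apply, pathLaw_apply, klDiv_comp_pathFromState, klDiv_self, zero_add,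
    Measure.lintegral_bind (Kernel.aemeasurable _) hm.aemeasurable]
  exact lintegral_congr fun x => klDiv_pathFrom p p' n s x

end DiffusionPolicy

/-! ### Time reversal of the forward chain -/

section Reversal

variable {S A : Type*} [MeasurableSpace S] [MeasurableSpace A]

lemma measurable_last_pair (n : ℕ) : Measurable fun w : Fin (n + 2) → A =>
    (w (Fin.last (n + 1)), w (Fin.last n).castSucc) := by
  fun_prop

variable (q : ℕ → Kernel A A) [∀ n, IsMarkovKernel (q n)] (ρ : Kernel S A) [IsMarkovKernel ρ]

/-- The law of `aⁿ` under the forward chain. -/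
noncomputable def forwardMarginal (n : ℕ) : Kernel S A :=
  (forwardKernel q ρ n).map fun w => w (Fin.last n)

/-- The law of `(aⁿ⁺¹, aⁿ)` under the forward chain. -/
noncomputable def forwardPair (n : ℕ) : Kernel S (A × A) :=
  (forwardKernel q ρ (n + 1)).map fun w => (w (Fin.last (n + 1)), w (Fin.last n).castSucc)

instance (n : ℕ) : IsMarkovKernel (forwardMarginal q ρ n) :=
  Kernel.IsMarkovKernel.map _ (measurable_pi_apply _)

instance (n : ℕ) : IsMarkovKernel (forwardPair q ρ n) :=
  Kernel.IsMarkovKernel.map _ (measurable_last_pair n)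

lemma fst_forwardPair (n : ℕ) : (forwardPair q ρ n).fst = forwardMarginal q ρ (n + 1) := by
  rw [Kernel.fst_eq, forwardPair, ← Kernel.map_comp_right _ (measurable_last_pair n) measurable_fst]
  rfl

lemma lintegral_forwardPair (n : ℕ) (s : S) {g : A × A → ℝ≥0∞} (hg : Measurable g) :
    ∫⁻ z, g z ∂forwardPair q ρ n s =
      ∫⁻ y, ∫⁻ a, g (a, y) ∂q n y ∂forwardMarginal q ρ n s := by
  have hg' : Measurable fun y => ∫⁻ a, g (a, y) ∂q n y :=
    (hg.comp measurable_swap).lintegral_kernel_prod_right'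
  have hgl : Measurable fun w : Fin (n + 2) → A =>
      g (w (Fin.last (n + 1)), w (Fin.last n).castSucc) := hg.comp (measurable_last_pair n)
  rw [forwardPair, Kernel.lintegral_map _ (measurable_last_pair n) _ hg, forwardKernel_apply,
    lintegral_forwardLaw_succ q _ n hgl, forwardMarginal,
    Kernel.lintegral_map _ (measurable_pi_apply _) _ hg', forwardKernel_apply]
  refine lintegral_congr fun w => lintegral_congr fun a => ?_
  simp

variable [StandardBorelSpace A]

/-- The time reversal of the forward chain with initial laws `ρ`. -/
noncomputable def reversePolicy [Nonempty A] : DiffusionPolicy S A where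
  trans n := (forwardPair q ρ n).condKernel
  markov _ := inferInstance

lemma lintegral_forwardPair_eq_reverse [Nonempty A] (n : ℕ) (s : S) {g : A × A → ℝ≥0∞}
    (hg : Measurable g) :
    ∫⁻ z, g z ∂forwardPair q ρ n s =
      ∫⁻ a, ∫⁻ y, g (a, y) ∂(reversePolicy q ρ).trans n (s, a)
        ∂forwardMarginal q ρ (n + 1) s := by
  conv_lhs => rw [← (forwardPair q ρ n).disintegrate (forwardPair q ρ n).condKernel]
  rw [Kernel.lintegral_compProd _ _ _ hg, fst_forwardPair]
  rfl

/-- The forward chain is its time reversal started from the final marginal. -/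
lemma lintegral_forwardLaw_eq_reverse [Nonempty A] (n : ℕ) (s : S)
    {f : (Fin (n + 1) → A) → ℝ≥0∞} (hf : Measurable f) :
    ∫⁻ w, f w ∂forwardLaw q (ρ s) n =
      ∫⁻ x, ∫⁻ w, f w ∂(reversePolicy q ρ).pathFrom n (s, x) ∂forwardMarginal q ρ n s := by
  induction n with
  | zero =>
    have hf' : Measurable fun a : A => f fun _ => a := by fun_prop
    have h (w : Fin 1 → A) : (fun _ => w (Fin.last 0)) = w := by
      funext i
      rw [Subsingleton.elim i (Fin.last 0)]
    simp only [DiffusionPolicy.lintegral_pathFrom_zero _ _ hf]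
    rw [forwardMarginal, Kernel.lintegral_map _ (measurable_pi_apply _) _ hf', forwardKernel_apply]
    simp only [h]
  | succ n ih =>
    set p := reversePolicy q ρ
    have hfs : Measurable fun z : (Fin (n + 1) → A) × A => f (Fin.snoc z.1 z.2) :=
      hf.comp (measurable_snoc (n + 1))
    have hg : Measurable fun z : A × A => ∫⁻ w, f (Fin.snoc w z.1) ∂p.pathFrom n (s, z.2) :=
      Measurable.lintegral_kernel_prod_right' (κ := (p.pathFrom n).comap
        (fun z : A × A => (s, z.2)) (by fun_prop))
        (f := fun v : (A × A) × (Fin (n + 1) → A) => f (Fin.snoc v.2 v.1.1))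
        (hfs.comp (measurable_snd.prodMk (measurable_fst.comp measurable_fst)))
    -- Reverse paths from y almost surely have last coordinate y, so the noising kernel no longer
    -- depends on the path and the integrals can be swapped.
    have hstep (y : A) : ∫⁻ w, ∫⁻ a, f (Fin.snoc w a) ∂q n (w (Fin.last n)) ∂p.pathFrom n (s, y) =
        ∫⁻ a, ∫⁻ w, f (Fin.snoc w a) ∂p.pathFrom n (s, y) ∂q n y := by
      rw [← lintegral_lintegral_swap hfs.aemeasurable]
      refine lintegral_congr_ae ?_
      filter_upwards [DiffusionPolicy.ae_pathFrom_last p n s y] with w hw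
      rw [hw]
    rw [lintegral_forwardLaw_succ q _ n hf, ih (measurable_lintegral_forward_step q n hf)]
    simp only [hstep, DiffusionPolicy.lintegral_pathFrom_succ p n s _ hf]
    -- The law of (aⁿ⁺¹, aⁿ), factored forwards and then backwards, exchanges the noising step for
    -- the reverse step.
    rw [← lintegral_forwardPair q ρ n s hg, lintegral_forwardPair_eq_reverse q ρ n s hg]

/-- A forward chain that ends in the prior is generated by its time reversal. -/
theorem pathLaw_reversePolicy [Nonempty A] (prior : Measure A) [IsProbabilityMeasure prior] (n : ℕ)
    (s : S) (h : (forwardLaw q (ρ s) n).map (fun w => w (Fin.last n)) = prior) :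
    (reversePolicy q ρ).pathLaw prior n s = forwardLaw q (ρ s) n := by
  refine Measure.ext_of_lintegral _ fun f hf => ?_
  have hprior : forwardMarginal q ρ n s = prior := by
    rw [forwardMarginal, Kernel.map_apply _ (measurable_pi_apply _), forwardKernel_apply, h]
  rw [lintegral_forwardLaw_eq_reverse q ρ n s hf, hprior, DiffusionPolicy.pathLaw_apply,
    Measure.lintegral_bind (Kernel.aemeasurable _) hf.aemeasurable]
  rfl

/-- The behavior diffusion process reverses the forward chain exactly. -/
theorem DiffusionPolicy.IsBehaviorDiffusion.pathLaw_eq {q : ℕ → Kernel A A}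
    [∀ n, IsMarkovKernel (q n)] {ρ : Kernel S A} [IsMarkovKernel ρ] {prior : Measure A}
    [IsProbabilityMeasure prior] {n : ℕ} {p : DiffusionPolicy S A}
    (hp : p.IsBehaviorDiffusion q ρ prior n)
    (h : ∀ s, (forwardLaw q (ρ s) n).map (fun w => w (Fin.last n)) = prior) (s : S) :
    p.pathLaw prior n s = forwardLaw q (ρ s) n := by
  have := nonempty_of_isProbabilityMeasure prior
  -- The reversal is a competitor with divergence zero, so the minimizer has divergence zero as
  -- well.
  have hle := hp (reversePolicy q ρ) s
  rw [pathLaw_reversePolicy q ρ prior n s (h s), klDiv_self] at hle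
  exact (klDiv_eq_zero_iff.1 (nonpos_iff_eq_zero.1 hle)).symm

end Reversal

/-- Noising two action laws with the same kernels does not change their divergence. -/
lemma klDiv_forwardLaw {A : Type*} [MeasurableSpace A] (q : ℕ → Kernel A A)
    [∀ n, IsMarkovKernel (q n)] (ρ ρ' : Measure A) [IsProbabilityMeasure ρ]
    [IsProbabilityMeasure ρ'] (n : ℕ) :
    klDiv (forwardLaw q ρ n) (forwardLaw q ρ' n) = klDiv ρ ρ' := by
  induction n with
  | zero =>
    exact klDiv_map_of_leftInverse ρ ρ' (f := fun a (_ : Fin 1) => a) (g := fun w => w 0)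
      (by fun_prop) (measurable_pi_apply 0) fun _ => rfl
  | succ n ih =>
    have hinv : Measurable fun w : Fin (n + 2) → A =>
        ((Fin.init w : Fin (n + 1) → A), w (Fin.last (n + 1))) :=
      (measurable_pi_lambda _ fun i => measurable_pi_apply i.castSucc).prodMk
        (measurable_pi_apply _)
    rw [forwardLaw, forwardLaw, klDiv_map_of_leftInverse _ _ (measurable_snoc (n + 1)) hinv
      fun z => by simp, klDiv_compProd_left, ih]

/-! ### Transfer between actions and paths, and the two objectives -/

section Objectives

variable {S A : Type*} [MeasurableSpace S] [MeasurableSpace A]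

lemma softValue_comp_zero {N : ℕ} {ν : Kernel S A} {κ : Kernel S (Fin (N + 1) → A)}
    (hκ : ∀ s, (κ s).map (fun w => w 0) = ν s) (η : ℝ) {Q : S × A → ℝ} (hQ : Measurable Q) :
    softValue κ η (fun z => Q (z.1, z.2 0)) = softValue ν η Q := by
  funext s
  rw [softValue, softValue, ← hκ s,
    integral_map (measurable_pi_apply 0).aemeasurable
      (Measurable.aestronglyMeasurable (by fun_prop))]

/-- Tilting by a function of a⁰ commutes with noising, normalizing constant included. -/
lemma softPolicy_comp_zero {N : ℕ} (q : ℕ → Kernel A A) [∀ n, IsMarkovKernel (q n)]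
    {ν : Kernel S A} [IsMarkovKernel ν] {κ : Kernel S (Fin (N + 1) → A)} [IsMarkovKernel κ]
    (hκ : ∀ s, κ s = forwardLaw q (ν s) N) (η : ℝ) {Q : S × A → ℝ} (hQ : Measurable Q) (s : S) :
    softPolicy κ η (fun z => Q (z.1, z.2 0)) s = forwardLaw q (softPolicy ν η Q s) N := by
  have hQ' : Measurable fun z : S × (Fin (N + 1) → A) => Q (z.1, z.2 0) :=
    hQ.comp (measurable_fst.prodMk ((measurable_pi_apply 0).comp measurable_snd))
  rw [softPolicy_apply κ η hQ', softPolicy_apply ν η hQ, hκ,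
    forwardLaw_tilted q (ν s) (f := fun a => Q (s, a) / η) (by fun_prop)]

variable [StandardBorelSpace A]

lemma actionObjective_eq (M : MDP S A) {η : ℝ} (hη : 0 < η) (ν : Kernel S A) [IsMarkovKernel ν]
    {V : S → ℝ} (hV : Measurable V) {K : ℝ} (hK : ∀ s, |V s| ≤ K)
    (hfix : ∀ s, softValue ν η (qValue M.T M.γ M.R V) s = V s) (π : Kernel S A) [IsMarkovKernel π]
    (s : S) :
    actionObjective M η ν π s =
      (V s : EReal) - (policyGap M.T ν π M.γ η (qValue M.T M.γ M.R V) s : EReal) := by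
  obtain ⟨C, hC⟩ := M.bounded_R
  exact discountedReturn_eq_sub_policyGap M.T ν π M.γ_nonneg M.γ_lt_one hη M.measurable_R hC hV hK
    hfix ((measurable_klDiv π ν).comp measurable_fst) (fun s => by simp) s

lemma objective_eq (M : MDP S A) {η : ℝ} (hη : 0 < η) (prior : Measure A)
    [IsProbabilityMeasure prior] (N : ℕ) (pν : DiffusionPolicy S A) {V : S → ℝ}
    (hV : Measurable V) {K : ℝ} (hK : ∀ s, |V s| ≤ K)
    (hfix : ∀ s, softValue (pν.pathLaw prior N) η
      (fun z => qValue M.T M.γ M.R V (z.1, z.2 0)) s = V s) (p : DiffusionPolicy S A) (s : S) :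
    DiffusionPolicy.objective M η prior N pν p s =
      (V s : EReal) - (policyGap (M.T.comap (fun z : S × (Fin (N + 1) → A) => (z.1, z.2 0))
        (measurable_fst.prodMk ((measurable_pi_apply 0).comp measurable_snd)))
        (pν.pathLaw prior N) (p.pathLaw prior N) M.γ η
        (fun z => qValue M.T M.γ M.R V (z.1, z.2 0)) s : EReal) := by
  obtain ⟨C, hC⟩ := M.bounded_R
  exact discountedReturn_eq_sub_policyGap _ (pν.pathLaw prior N) (p.pathLaw prior N) M.γ_nonneg
    M.γ_lt_one hη (r := fun z : S × (Fin (N + 1) → A) => M.R (z.1, z.2 0))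
    (M.measurable_R.comp (measurable_fst.prodMk ((measurable_pi_apply 0).comp measurable_snd)))
    (fun z => hC _) hV hK hfix (DiffusionPolicy.measurable_pathPenalty p pν N)
    (fun s => (DiffusionPolicy.klDiv_pathLaw p pν prior N s).symm) s

lemma coe_sub_coe_ennreal_le (v : ℝ) (x : ℝ≥0∞) : (v : EReal) - (x : EReal) ≤ v := by
  simpa using EReal.sub_le_sub (le_refl (v : EReal)) (EReal.coe_ennreal_nonneg x)

lemma eq_zero_of_le_coe_sub_coe_ennreal {v : ℝ} {x : ℝ≥0∞}
    (h : (v : EReal) ≤ (v : EReal) - (x : EReal)) : x = 0 := by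
  by_cases hx : x = ∞
  · rw [hx] at h
    simp at h
  · rw [← EReal.coe_ennreal_toReal hx, ← EReal.coe_sub, EReal.coe_le_coe_iff] at h
    have h₀ : x.toReal = 0 := le_antisymm (by linarith) ENNReal.toReal_nonneg
    exact (ENNReal.toReal_eq_zero_iff x).1 h₀ |>.resolve_right hx

end Objectives

end PathwiseKL

/-! ### The main theorem -/

theorem theorem4p2 {S A : Type*} [MeasurableSpace S] [MeasurableSpace A] [StandardBorelSpace A]
    (M : PathwiseKL.MDP S A) (η : ℝ) (hη : 0 < η)
    (N : ℕ) (prior : Measure A) [IsProbabilityMeasure prior]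
    (ν : Kernel S A) [IsMarkovKernel ν]
    (q : ℕ → Kernel A A) [∀ n, IsMarkovKernel (q n)]
    -- the forward process turns every action law dominated by `ν(· | s)` into the prior noise
    (hq : ∀ (s : S) (ρ : Measure A), IsProbabilityMeasure ρ → ρ ≪ ν s →
      (PathwiseKL.forwardLaw q ρ N).map (fun w => w (Fin.last N)) = prior)
    (pν : PathwiseKL.DiffusionPolicy S A)
    (hpν : PathwiseKL.DiffusionPolicy.IsBehaviorDiffusion q ν prior N pν) :
    (∃ p : PathwiseKL.DiffusionPolicy S A,
      PathwiseKL.DiffusionPolicy.IsOptimal M η prior N pν p) ∧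
    ∃ (πopt : Kernel S A) (_ : IsMarkovKernel πopt),
      PathwiseKL.IsActionOptimal M η ν πopt ∧
      (∀ (π : Kernel S A) [IsMarkovKernel π], PathwiseKL.IsActionOptimal M η ν π → π = πopt) ∧
      ∀ p : PathwiseKL.DiffusionPolicy S A,
        PathwiseKL.DiffusionPolicy.IsOptimal M η prior N pν p →
        ∀ s : S,
          (p.pathLaw prior N s).map (fun w => w 0) = πopt s ∧
          klDiv (p.pathLaw prior N s) (pν.pathLaw prior N s) = klDiv (πopt s) (ν s) ∧
          PathwiseKL.DiffusionPolicy.objective M η prior N pν p s =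
            PathwiseKL.actionObjective M η ν πopt s := by
  open PathwiseKL in
  have hA := nonempty_of_isProbabilityMeasure prior
  obtain ⟨C, hC⟩ := M.bounded_R
  obtain ⟨V, hV, ⟨K, hK⟩, hfix⟩ :=
    exists_softValue_qValue_eq M.T ν M.γ_nonneg M.γ_lt_one hη M.measurable_R hC
  set Q := qValue M.T M.γ M.R V
  have hQ : Measurable Q := measurable_qValue M.T M.γ M.measurable_R hV
  have hQK := abs_qValue_le M.T M.γ_nonneg hC hK
  have hQ' : Measurable fun z : S × (Fin (N + 1) → A) => Q (z.1, z.2 0) :=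
    hQ.comp (measurable_fst.prodMk ((measurable_pi_apply 0).comp measurable_snd))
  have hπ : IsMarkovKernel (softPolicy ν η Q) := isMarkovKernel_softPolicy ν hη hQ hQK
  have hπac (s : S) : softPolicy ν η Q s ≪ ν s := by
    rw [softPolicy_apply ν η hQ]
    exact tilted_absolutelyContinuous _ _
  -- the behavior diffusion and the soft policy relative to it are forward processes
  have hpath := hpν.pathLaw_eq fun s => hq s (ν s) inferInstance Measure.AbsolutelyContinuous.rfl
  have hsoft := softPolicy_comp_zero q hpath η hQ
  have hfix' (s : S) :
      softValue (pν.pathLaw prior N) η (fun z => Q (z.1, z.2 0)) s = V s := by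
    rw [softValue_comp_zero (ν := ν) (fun s => by rw [hpath, map_zero_forwardLaw]) η hQ, hfix]
  have hact (π : Kernel S A) [IsMarkovKernel π] (s : S) :=
    actionObjective_eq M hη ν hV hK hfix π s
  have hdiff := objective_eq M hη prior N pν hV hK hfix'
  have hopt (s : S) : actionObjective M η ν (softPolicy ν η Q) s = V s := by
    rw [hact, policyGap_eq_zero M.T ν (softPolicy ν η Q) (fun s => rfl) s]
    simp
  -- the time reversal of the noised optimal policy attains the same value
  have hrev (s : S) :
      DiffusionPolicy.objective M η prior N pν (reversePolicy q (softPolicy ν η Q)) s = V s := by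
    rw [hdiff, policyGap_eq_zero]
    · simp
    · intro s
      rw [hsoft, pathLaw_reversePolicy q (softPolicy ν η Q) prior N s
        (hq s _ inferInstance (hπac s))]
  refine ⟨⟨reversePolicy q (softPolicy ν η Q), fun p s => ?_⟩, softPolicy ν η Q, hπ,
    fun π _ s => ?_, fun π _ hπopt => ?_, fun p hp s => ?_⟩
  · rw [hrev, hdiff]
    exact coe_sub_coe_ennreal_le _ _
  · rw [hopt, hact π]
    exact coe_sub_coe_ennreal_le _ _
  · ext1 s
    -- Comparison with the soft policy, whose return is V(s), forces the gap of π to vanish at every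
    -- state.
    have h := hπopt (softPolicy ν η Q) s
    rw [hopt, hact π] at h
    exact eq_softPolicy_of_policyGap_eq_zero M.T ν π hη hQ hQK
      (eq_zero_of_le_coe_sub_coe_ennreal h)
  · have h := hp (reversePolicy q (softPolicy ν η Q)) s
    rw [hrev, hdiff] at h
    have hgap := eq_zero_of_le_coe_sub_coe_ennreal h
    -- The gap is measured on path space, so optimality fixes the entire path law; all three claims
    -- follow from this.
    have hlaw : p.pathLaw prior N s = forwardLaw q (softPolicy ν η Q s) N := by
      rw [← hsoft]
      exact eq_softPolicy_of_policyGap_eq_zero _ _ _ hη hQ' (fun z => hQK _) hgap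
    refine ⟨?_, ?_, ?_⟩
    · rw [hlaw, map_zero_forwardLaw]
    · rw [hlaw, hpath, klDiv_forwardLaw]
    · rw [hdiff, hgap, hopt]
      simp
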